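/- Let $G$ be a finite group and let $V$ be a simple $\mathbb{C}[G]$-module of (complex) dimension $d$ such that $d(d+2) = |G|$. Then $G$ is a cyclic group of order $3$, or $G$ is a nonabelian group of order $8$. -/

import Mathlib

/-! ### Class counting in a group of order 4q(q-1) with a normal subgroup of order q -/

section ConjugacyClasses

variable {G : Type*} [Group G]

/-! For d = 1 the order is the prime 3. Let d ≥ 2, and let ρ be the given representation with
character χ. In the regular representation ρ accounts for d², so the remaining irreducibles have
squared degrees summing to 2d. This is so little room that ρ ⊗ σ is a multiple of ρ for every
irreducible σ not isomorphic to ρ (`character_mul_character_eq`). Hence χ(g) ≠ 0 forces σ(g) = 1 for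
all such σ. Let N be the common kernel of these σ. Then χ vanishes off N, and the regular character
gives χ = -2 on N \ {1}. Characters separate classes, so N \ {1} is a single class and each x
outside N is conjugate to all of xN (`exists_normal_subgroup_of_large_degree`). Orthogonality to the
trivial character gives d = 2(q-1) with q = |N|, so |G| = 4q(q-1).

The rest is group theory: N is an elementary abelian 2-group, and counting the orbits on N of the
centralizer of some g ≠ 1 in N gives q + 6 ≡ 0 mod 4. Hence q = 2 and |G| = 8
(`card_eq_two_of_transitive`). -/

theorem card_isConj_mul_card_centralizer [Finite G] (g : G) :
    Nat.card {x | IsConj g x} * Nat.card (Subgroup.centralizer {g}) = Nat.card G := by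
  have h := (MulAction.stabilizer (ConjAct G) g).index_mul_card
  rw [MulAction.index_stabilizer, ← Subgroup.nat_card_centralizer_nat_card_stabilizer] at h
  have horb : MulAction.orbit (ConjAct G) g = {x | IsConj g x} :=
    Set.ext fun x ↦ ConjAct.mem_orbit_conjAct.trans isConj_comm
  rw [horb] at h
  exact h

/-- Since N is normal, conjugation carries the hypothesis from x to its whole class, which is
therefore a union of cosets of N. -/
theorem card_dvd_card_isConj {N : Subgroup G} {x : G} (h : ∀ n ∈ N, IsConj x (x * n))
    [N.Normal] : Nat.card N ∣ Nat.card {y | IsConj x y} := by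
  have hclosed (y : G) (hy : IsConj x y) (n : G) (hn : n ∈ N) : IsConj x (y * n) := by
    obtain ⟨c, rfl⟩ := isConj_iff.1 hy
    refine (h (c⁻¹ * n * c) ?_).trans (isConj_iff.2 ⟨c, by group⟩)
    simpa using Subgroup.Normal.conj_mem inferInstance n hn c⁻¹
  have hpre : {y | IsConj x y} =
      (QuotientGroup.mk : G → G ⧸ N) ⁻¹' (QuotientGroup.mk '' {y | IsConj x y}) := by
    refine (Set.subset_preimage_image _ _).antisymm ?_
    rintro z ⟨y, hy, hyz⟩
    have := hclosed y hy _ (QuotientGroup.eq.1 hyz)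
    rwa [mul_inv_cancel_left] at this
  rw [hpre, Nat.card_congr (QuotientGroup.preimageMkEquivSubgroupProdSet N _), Nat.card_prod]
  exact Nat.dvd_mul_right _ _

variable [Finite G] {N : Subgroup G} [hnorm : N.Normal]

theorem card_isConj_of_transitive (hN : ∀ x ∈ N, ∀ y ∈ N, x ≠ 1 → y ≠ 1 → IsConj x y) {g : G}
    (hg : g ∈ N) (hg1 : g ≠ 1) : Nat.card {x | IsConj g x} + 1 = Nat.card N := by
  have : {x | IsConj g x} = (N : Set G) \ {1} := by
    ext x
    simp only [Set.mem_ofPred_eq, Set.mem_sdiff, SetLike.mem_coe, Set.mem_singleton_iff]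
    refine ⟨fun h ↦ ?_, fun h ↦ hN g hg x h.1 hg1 h.2⟩
    obtain ⟨c, rfl⟩ := isConj_iff.1 h
    exact ⟨hnorm.conj_mem g hg c, by simpa using hg1⟩
  rw [this, Nat.card_coe_set_eq, Set.ncard_sdiff_singleton_add_one N.one_mem (Set.toFinite _)]
  rfl

variable (hN : ∀ x ∈ N, ∀ y ∈ N, x ≠ 1 → y ≠ 1 → IsConj x y)
  (hx : ∀ x ∉ N, ∀ n ∈ N, IsConj x (x * n))
  (hG : Nat.card G = 4 * Nat.card N * (Nat.card N - 1))

include hN hG in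
theorem card_centralizer_of_mem {g : G} (hg : g ∈ N) (hg1 : g ≠ 1) :
    Nat.card (Subgroup.centralizer {g}) = 4 * Nat.card N := by
  have h1 := card_isConj_of_transitive hN hg hg1
  have h2 := card_isConj_mul_card_centralizer g
  have h3 : 0 < Nat.card G := Nat.card_pos
  rw [hG, ← h1, Nat.add_sub_cancel] at h2
  rw [hG, ← h1, Nat.add_sub_cancel] at h3
  rw [← h1]
  refine Nat.eq_of_mul_eq_mul_left (Nat.pos_of_mul_pos_left h3) (h2.trans (mul_comm _ _))

include hx hG in
theorem card_centralizer_dvd_of_notMem {x : G} (hxN : x ∉ N) :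
    Nat.card (Subgroup.centralizer {x}) ∣ 4 * (Nat.card N - 1) := by
  obtain ⟨k, hk⟩ := card_dvd_card_isConj (hx x hxN)
  have h := card_isConj_mul_card_centralizer x
  rw [hk, hG] at h
  refine ⟨k, Nat.eq_of_mul_eq_mul_left (Nat.card_pos (α := N)) ?_⟩
  linarith

include hN hx hG in
theorem sq_eq_one_of_transitive (hq : 2 ≤ Nat.card N) : ∀ n ∈ N, n ^ 2 = 1 := by
  have : Nontrivial N := Finite.one_lt_card_iff_nontrivial.1 hq
  obtain ⟨⟨g, hg⟩, hg1⟩ := exists_ne (1 : N)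
  replace hg1 : g ≠ 1 := fun h ↦ hg1 (Subtype.ext h)
  -- If |N| were odd, an involution t centralizing g would lie outside N and so be conjugate to tg.
  -- Then 1 = (tg)² = g², impossible for g ≠ 1 of odd order.
  have h2 : 2 ∣ Nat.card N := by
    by_contra hodd
    have hodd' : Odd (Nat.card N) := by rwa [← Nat.not_even_iff_odd, even_iff_two_dvd]
    have hsq (a : G) (ha : a ∈ N) (ha2 : a ^ 2 = 1) : a = 1 := by
      have h1 : orderOf a ∣ 2 := orderOf_dvd_of_pow_eq_one ha2
      have h3 : orderOf a ∣ Nat.card N := by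
        rw [← Subgroup.orderOf_mk a ha]; exact orderOf_dvd_natCard _
      rw [← orderOf_eq_one_iff]
      exact Nat.eq_one_of_dvd_coprimes hodd'.coprime_two_left h1 h3
    have : Fact (Nat.Prime 2) := ⟨Nat.prime_two⟩
    obtain ⟨⟨t, htC⟩, ht⟩ := exists_prime_orderOf_dvd_card' (G := Subgroup.centralizer {g}) 2
      (by rw [card_centralizer_of_mem hN hG hg hg1]; omega)
    rw [Subgroup.orderOf_mk] at ht
    have ht2 : t ^ 2 = 1 := by rw [← ht, pow_orderOf_eq_one]
    have htN : t ∉ N := fun h ↦ by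
      have := hsq t h ht2
      subst this
      simp at ht
    obtain ⟨c, hc⟩ := isConj_iff.1 (hx t htN g hg)
    have hcomm : Commute t g := (Subgroup.mem_centralizer_singleton_iff.1 htC)
    have : (t * g) ^ 2 = 1 := by rw [← hc, conj_pow, ht2]; simp
    rw [hcomm.mul_pow, ht2, one_mul] at this
    exact hg1 (hsq g hg this)
  have : Fact (Nat.Prime 2) := ⟨Nat.prime_two⟩
  obtain ⟨⟨t, htN⟩, ht⟩ := exists_prime_orderOf_dvd_card' (G := N) 2 h2
  rw [Subgroup.orderOf_mk] at ht
  have ht2 : t ^ 2 = 1 := by rw [← ht, pow_orderOf_eq_one]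
  intro n hn
  by_cases hn1 : n = 1
  · simp [hn1]
  · obtain ⟨c, rfl⟩ := isConj_iff.1 (hN t htN n hn (by rintro rfl; simp at ht) hn1)
    rw [conj_pow, ht2]; simp

include hN hx hG in
-- The common centralizer of g and x has order dividing both 4q and 4(q-1), with q a power of 2,
-- hence at most 4. A third choice of h would put the five elements 1, g, h, gh, x in it.
theorem mem_pair_of_commute {k : ℕ} (hk : Nat.card N = 2 ^ (k + 1)) (hsq : ∀ n ∈ N, n ^ 2 = 1)
    {g h x : G} (hg : g ∈ N) (hg1 : g ≠ 1) (hh : h ∈ N) (hxN : x ∉ N)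
    (hgh : Commute g h) (hxg : Commute x g) (hxh : Commute x h) : h = 1 ∨ h = g := by
  classical
  by_contra! hne
  let H : Subgroup G := Subgroup.centralizer {g} ⊓ Subgroup.centralizer {x}
  have h1 : Nat.card H ∣ 2 ^ (k + 3) := by
    have := Subgroup.card_dvd_of_le (inf_le_left : H ≤ Subgroup.centralizer {g})
    rw [card_centralizer_of_mem hN hG hg hg1, hk] at this
    convert this using 1
    ring
  have h2 : Nat.card H ∣ 4 * (2 ^ (k + 1) - 1) := by
    rw [← hk]
    exact (Subgroup.card_dvd_of_le (inf_le_right : H ≤ Subgroup.centralizer {x})).trans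
      (card_centralizer_dvd_of_notMem hx hG hxN)
  have hcop : Nat.Coprime (2 ^ (k + 3)) (2 ^ (k + 1) - 1) := by
    apply Nat.Coprime.pow_left
    rw [Nat.coprime_two_left, ← Nat.not_even_iff_odd]
    have : 2 ^ (k + 1) = 2 * 2 ^ k := by ring
    have := Nat.two_pow_pos k
    rintro ⟨m, hm⟩
    omega
  have h4 : Nat.card H ≤ 4 :=
    Nat.le_of_dvd (by norm_num) ((Nat.Coprime.coprime_dvd_left h1 hcop).dvd_of_dvd_mul_right h2)
  have hmem (y : G) (hyg : Commute y g) (hyx : Commute y x) : y ∈ H :=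
    ⟨Subgroup.mem_centralizer_singleton_iff.2 hyg, Subgroup.mem_centralizer_singleton_iff.2 hyx⟩
  have hsub : (({1, g, h, g * h, x} : Finset G) : Set G) ⊆ H := by
    intro y hy
    simp only [Finset.coe_insert, Finset.coe_singleton, Set.mem_insert_iff,
      Set.mem_singleton_iff] at hy
    rcases hy with rfl | rfl | rfl | rfl | rfl
    · exact H.one_mem
    · exact hmem _ (Commute.refl _) hxg.symm
    · exact hmem _ hgh.symm hxh.symm
    · exact hmem _ ((Commute.refl g).mul_left hgh.symm) (hxg.symm.mul_left hxh.symm)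
    · exact hmem _ hxg (Commute.refl _)
  have hxne (y : G) (hy : y ∈ N) : y ≠ x := fun e ↦ hxN (e ▸ hy)
  have hgh1 : g * h ≠ 1 := fun e ↦ hne.2 (by
    have := hsq g hg
    rw [sq] at this
    exact mul_left_cancel (e.trans this.symm))
  have hcard : ({1, g, h, g * h, x} : Finset G).card = 5 := by
    rw [Finset.card_insert_of_notMem, Finset.card_insert_of_notMem, Finset.card_insert_of_notMem,
      Finset.card_insert_of_notMem, Finset.card_singleton]
    · simpa using hxne _ (N.mul_mem hg hh)
    · simpa using ⟨hg1, hxne _ hh⟩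
    · simpa using ⟨hne.2.symm, hne.1, hxne _ hg⟩
    · simpa using ⟨hg1.symm, hne.1.symm, hgh1.symm, hxne _ N.one_mem⟩
  have := Set.ncard_le_ncard hsub (Set.toFinite _)
  rw [Set.ncard_coe_finset, hcard] at this
  have h5 : 5 ≤ Nat.card H := this
  omega

include hN hx hG in
theorem card_eq_two_of_transitive (hq : 2 ≤ Nat.card N) : Nat.card N = 2 := by
  classical
  have := Fintype.ofFinite G
  have hsq := sq_eq_one_of_transitive hN hx hG hq
  have hcomm (a b : G) (ha : a ∈ N) (hb : b ∈ N) : Commute a b := by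
    have h := hsq _ (N.mul_mem ha hb)
    have ha' := hsq a ha
    have hb' := hsq b hb
    rw [sq, ← eq_inv_iff_mul_eq_one] at h ha' hb'
    rw [Commute, SemiconjBy, h, mul_inv_rev, ← ha', ← hb']
  have hp : IsPGroup 2 N := fun n ↦ ⟨1, Subtype.ext (by simpa using hsq n n.2)⟩
  have : Fact (Nat.Prime 2) := ⟨Nat.prime_two⟩
  obtain ⟨j, hj⟩ := IsPGroup.iff_card.1 hp
  obtain _ | k := j
  · omega
  have : Nontrivial N := Finite.one_lt_card_iff_nontrivial.1 hq
  obtain ⟨⟨g, hg⟩, hg1⟩ := exists_ne (1 : N)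
  replace hg1 : g ≠ 1 := fun h ↦ hg1 (Subtype.ext h)
  let P := Subgroup.centralizer {g}
  have hNP : N ≤ P := fun n hn ↦ Subgroup.mem_centralizer_singleton_iff.2 (hcomm n g hn hg)
  let _ : MulAction P N := MulAction.compHom N ((MulAut.conjNormal (H := N)).comp P.subtype)
  have hfix (y : P) (n : N) : n ∈ MulAction.fixedBy N y ↔ Commute (y : G) n := by
    rw [MulAction.mem_fixedBy, Subtype.ext_iff]
    change (y : G) * n * (y : G)⁻¹ = n ↔ _
    rw [mul_inv_eq_iff_eq_mul]
    rfl
  have hcount (y : P) : Fintype.card (MulAction.fixedBy N y) =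
      if (y : G) ∈ N then Nat.card N else 2 := by
    rw [← Nat.card_eq_fintype_card]
    split_ifs with hy
    · rw [show MulAction.fixedBy N y = Set.univ from
        Set.eq_univ_of_forall fun n ↦ (hfix y n).2 (hcomm _ _ hy n.2), Nat.card_univ]
    · have hyg : Commute (y : G) g := Subgroup.mem_centralizer_singleton_iff.1 y.2
      rw [show MulAction.fixedBy N y = {1, ⟨g, hg⟩} by
        ext n
        rw [hfix, Set.mem_insert_iff, Set.mem_singleton_iff, Subtype.ext_iff, Subtype.ext_iff]
        refine ⟨fun h ↦ mem_pair_of_commute hN hx hG hj hsq hg hg1 n.2 hy (hcomm _ _ hg n.2)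
          hyg h, ?_⟩
        rintro (h | h) <;> rw [h]
        · exact Commute.one_right _
        · exact hyg]
      rw [Nat.card_coe_set_eq, Set.ncard_pair]
      exact fun h ↦ hg1 (congrArg Subtype.val h).symm
  -- Burnside's lemma: q elements of P fix all of N and the other 3q fix only 1 and g, so q·q + 3q·2
  -- = 4q·m with m the number of orbits.
  have hB := MulAction.sum_card_fixedBy_eq_card_orbits_mul_card_group P N
  have hP : Nat.card P = 4 * Nat.card N := card_centralizer_of_mem hN hG hg hg1
  have hin : (Finset.univ.filter fun y : P ↦ (y : G) ∈ N).card = Nat.card N := by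
    rw [← Fintype.card_subtype, ← Nat.card_eq_fintype_card]
    exact Nat.card_congr (Subgroup.subgroupOfEquivOfLe hNP).toEquiv
  have hout := Finset.card_filter_add_card_filter_not (s := (Finset.univ : Finset P))
    fun y : P ↦ (y : G) ∈ N
  rw [hin, Finset.card_univ, ← Nat.card_eq_fintype_card, hP] at hout
  rw [Finset.sum_congr rfl fun y _ ↦ hcount y, Finset.sum_ite, Finset.sum_const, Finset.sum_const,
    hin, show (Finset.univ.filter fun y : P ↦ (y : G) ∉ N).card = 3 * Nat.card N by omega,
    ← Nat.card_eq_fintype_card (α := P), hP, smul_eq_mul, smul_eq_mul] at hB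
  generalize Fintype.card (Quotient (MulAction.orbitRel P N)) = m at hB
  have hm : Nat.card N + 6 = 4 * m := by
    apply Nat.eq_of_mul_eq_mul_left (Nat.card_pos (α := N))
    linarith
  rw [hj] at hm ⊢
  -- If 4 divided q, then q + 6 = 4m would fail modulo 4.
  obtain _ | i := k
  · rfl
  · have : 2 ^ (i + 1 + 1) = 4 * 2 ^ i := by ring
    omega

include hN hx hG in
theorem card_eq_eight_of_transitive (hq : 2 ≤ Nat.card N) :
    (¬ ∀ a b : G, a * b = b * a) ∧ Nat.card G = 8 := by
  have h2 := card_eq_two_of_transitive hN hx hG hq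
  have h8 : Nat.card G = 8 := by rw [hG, h2]
  refine ⟨fun hcomm ↦ ?_, h8⟩
  have : Nontrivial N := Finite.one_lt_card_iff_nontrivial.1 hq
  obtain ⟨⟨g, hg⟩, hg1⟩ := exists_ne (1 : N)
  have hne : N ≠ ⊤ := by
    rintro rfl
    rw [Subgroup.card_top] at h2
    omega
  obtain ⟨x, -, hxN⟩ := SetLike.exists_of_lt hne.lt_top
  obtain ⟨c, hc⟩ := isConj_iff.1 (hx x hxN g hg)
  rw [hcomm c x, mul_inv_cancel_right] at hc
  exact hg1 (Subtype.ext (left_eq_mul.1 hc))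

end ConjugacyClasses

open Representation Module

/-! ### Complete reducibility -/

section Decomposition

variable {G V : Type*} [Group G] [AddCommGroup V] [Module ℂ V]

theorem Subrepresentation.isIrreducible_toRepresentation {ρ : Representation ℂ G V}
    {S : Subrepresentation ρ} (hS : IsAtom S) : IsIrreducible S.toRepresentation where
  exists_pair_ne := by
    refine ⟨⊥, ⊤, fun h ↦ hS.1 ?_⟩
    have h' : (⊥ : Submodule ℂ S.toSubmodule) = ⊤ := congrArg Subrepresentation.toSubmodule h
    apply Subrepresentation.toSubmodule_injective
    exact (Submodule.subsingleton_iff_eq_bot).1 (subsingleton_of_bot_eq_top h' |>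
      (Submodule.subsingleton_iff ℂ).1)
  eq_bot_or_eq_top T := by
    let T' : Subrepresentation ρ :=
      { toSubmodule := T.toSubmodule.map S.toSubmodule.subtype
        apply_mem_toSubmodule := by
          rintro g _ ⟨w, hw, rfl⟩
          exact ⟨S.toRepresentation g w, T.apply_mem_toSubmodule g hw, rfl⟩ }
    have hle : T' ≤ S := by
      rintro _ ⟨w, -, rfl⟩
      exact w.2
    rcases hS.le_iff.1 hle with h | h
    · left
      apply Subrepresentation.toSubmodule_injective
      have : T.toSubmodule.map S.toSubmodule.subtype = ⊥ :=
        congrArg Subrepresentation.toSubmodule h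
      apply Submodule.map_injective_of_injective S.toSubmodule.injective_subtype
      rw [this]
      exact (Submodule.map_bot _).symm
    · right
      apply Subrepresentation.toSubmodule_injective
      have : T.toSubmodule.map S.toSubmodule.subtype = S.toSubmodule :=
        congrArg Subrepresentation.toSubmodule h
      apply Submodule.map_injective_of_injective S.toSubmodule.injective_subtype
      rw [this]
      exact (Submodule.map_subtype_top _).symm

variable [FiniteDimensional ℂ V]

/-- Maschke's theorem, transported from submodules over the group algebra to subrepresentations. -/
theorem Representation.exists_isInternal_isIrreducible [Finite G] (ρ : Representation ℂ G V) :
    ∃ (n : ℕ) (S : Fin n → Subrepresentation ρ),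
      DirectSum.IsInternal (fun i ↦ (S i).toSubmodule) ∧
      ∀ i, IsIrreducible (S i).toRepresentation := by
  have : NeZero (Nat.card G : ℂ) := ⟨by exact_mod_cast Nat.card_pos.ne'⟩
  obtain ⟨s, hind, hsup, hs⟩ :=
    IsSemisimpleModule.exists_sSupIndep_sSup_simples_eq_top (MonoidAlgebra ℂ G) ρ.asModule
  have : Module.Finite (MonoidAlgebra ℂ G) ρ.asModule :=
    Module.Finite.of_restrictScalars_finite ℂ _ _
  have hfin : Finite s := WellFoundedGT.finite_of_iSupIndep ((sSupIndep_iff _).mp hind)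
    fun N ↦ by
      have := hs _ N.2
      exact (N.1.nontrivial_iff_ne_bot).mp (IsSimpleModule.nontrivial (MonoidAlgebra ℂ G) N)
  let e := Finite.equivFin s
  refine ⟨Nat.card s, fun i ↦ Subrepresentation.ofSubmodule' (e.symm i).1, ?_, fun i ↦ ?_⟩
  · have h1 : iSupIndep fun i ↦ (e.symm i).1 :=
      ((sSupIndep_iff _).mp hind).comp e.symm.injective
    have h2 : ⨆ i, (e.symm i).1 = ⊤ := by
      rw [← hsup, sSup_eq_iSup']
      exact e.symm.iSup_comp (g := fun N : s ↦ N.1)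
    have h3 := DirectSum.isInternal_submodule_of_iSupIndep_of_iSup_eq_top h1 h2
    exact h3
  · apply Subrepresentation.isIrreducible_toRepresentation
    have := hs _ (e.symm i).2
    have h : IsAtom (e.symm i).1 := isSimpleModule_iff_isAtom.1 this
    exact (OrderIso.isAtom_iff
      (Subrepresentation.subrepresentationSubmoduleOrderIso (ρ := ρ)).symm _).2 h

variable {ρ : Representation ℂ G V} {n : ℕ} {S : Fin n → Subrepresentation ρ}

theorem Representation.character_eq_sum_of_isInternal
    (hS : DirectSum.IsInternal (fun i ↦ (S i).toSubmodule)) (g : G) :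
    ρ.character g = ∑ i, (S i).toRepresentation.character g :=
  LinearMap.trace_eq_sum_trace_restrict hS fun i ↦ (S i).apply_mem_toSubmodule g

theorem Representation.finrank_eq_sum_of_isInternal
    (hS : DirectSum.IsInternal (fun i ↦ (S i).toSubmodule)) :
    finrank ℂ V = ∑ i, finrank ℂ (S i).toSubmodule := by
  have := character_eq_sum_of_isInternal hS 1
  simp only [char_one] at this
  exact_mod_cast this

end Decomposition

/-! ### Multiplicities of irreducible constituents -/

section Multiplicity

variable {G V W : Type*} [Group G] [AddCommGroup V] [Module ℂ V]
  [AddCommGroup W] [Module ℂ W] {ρ : Representation ℂ G V} {n : ℕ}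

open scoped Classical in
/-- The indices of the summands isomorphic to a given representation. -/
noncomputable def isoIndices (S : Fin n → Subrepresentation ρ) (σ : Representation ℂ G W) :
    Finset (Fin n) :=
  {i | Nonempty (Representation.Equiv σ (S i).toRepresentation)}

variable {S : Fin n → Subrepresentation ρ} {σ : Representation ℂ G W}

theorem mem_isoIndices {i : Fin n} :
    i ∈ isoIndices S σ ↔ Nonempty (Representation.Equiv σ (S i).toRepresentation) := by
  simp [isoIndices]

theorem finrank_of_mem_isoIndices {i : Fin n} (hi : i ∈ isoIndices S σ) :
    finrank ℂ (S i).toSubmodule = finrank ℂ W := by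
  obtain ⟨e⟩ := mem_isoIndices.1 hi
  exact e.toLinearEquiv.finrank_eq.symm

theorem character_of_mem_isoIndices {i : Fin n} (hi : i ∈ isoIndices S σ) :
    (S i).toRepresentation.character = σ.character := by
  obtain ⟨e⟩ := mem_isoIndices.1 hi
  exact (char_iso e).symm

theorem sum_finrank_isoIndices :
    ∑ i ∈ isoIndices S σ, finrank ℂ (S i).toSubmodule =
      (isoIndices S σ).card * finrank ℂ W := by
  rw [Finset.sum_congr rfl fun i hi ↦ finrank_of_mem_isoIndices hi, Finset.sum_const, smul_eq_mul]

theorem disjoint_isoIndices {W' : Type*} [AddCommGroup W'] [Module ℂ W']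
    {σ' : Representation ℂ G W'} (h : IsEmpty (Representation.Equiv σ σ')) :
    Disjoint (isoIndices S σ) (isoIndices S σ') := by
  rw [Finset.disjoint_left]
  intro i hi hi'
  obtain ⟨e⟩ := mem_isoIndices.1 hi
  obtain ⟨e'⟩ := mem_isoIndices.1 hi'
  exact h.false (e.trans e'.symm)

variable [FiniteDimensional ℂ V]

theorem card_isoIndices_mul_finrank_le (hS : DirectSum.IsInternal (fun i ↦ (S i).toSubmodule)) :
    (isoIndices S σ).card * finrank ℂ W ≤ finrank ℂ V := by
  rw [finrank_eq_sum_of_isInternal hS, ← sum_finrank_isoIndices]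
  exact Finset.sum_le_univ_sum_of_nonneg fun _ ↦ Nat.zero_le _

variable [FiniteDimensional ℂ W] [Fintype G]

/-- The pairing of functions on a finite group for which the irreducible characters are
orthonormal. -/
noncomputable def charPairing (f h : G → ℂ) : ℂ := (Nat.card G : ℂ)⁻¹ * ∑ g, f g * h g⁻¹

theorem charPairing_comm (f h : G → ℂ) : charPairing f h = charPairing h f := by
  unfold charPairing
  congr 1
  refine Fintype.sum_equiv (Equiv.inv G) _ _ fun g ↦ ?_
  simp [mul_comm]

theorem charPairing_eq_card_isoIndices [IsIrreducible σ]
    (hS : DirectSum.IsInternal (fun i ↦ (S i).toSubmodule))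
    (hirr : ∀ i, IsIrreducible (S i).toRepresentation) :
    charPairing ρ.character σ.character = (isoIndices S σ).card := by
  classical
  have : Invertible (Nat.card G : ℂ) :=
    invertibleOfNonzero (by exact_mod_cast Nat.card_pos.ne')
  have key (i : Fin n) : charPairing (S i).toRepresentation.character σ.character =
      if i ∈ isoIndices S σ then 1 else 0 := by
    have := hirr i
    rw [charPairing, char_orthonormal]
    simp only [mem_isoIndices]
  have : charPairing ρ.character σ.character =
      ∑ i, charPairing (S i).toRepresentation.character σ.character := by
    simp only [charPairing, character_eq_sum_of_isInternal hS, Finset.sum_mul, ← Finset.mul_sum]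
    rw [Finset.sum_comm]
  rw [this, Finset.sum_congr rfl fun i _ ↦ key i]
  simp

end Multiplicity

/-! ### The regular representation -/

section Regular

variable {G W : Type*}

instance [Finite G] : FiniteDimensional ℂ (MonoidAlgebra ℂ G) :=
  Module.Finite.of_basis (MonoidAlgebra.basis G ℂ)

theorem finrank_monoidAlgebra [Finite G] : finrank ℂ (MonoidAlgebra ℂ G) = Nat.card G := by
  rw [finrank_eq_nat_card_basis (MonoidAlgebra.basis G ℂ)]

variable [Group G] [Fintype G] [AddCommGroup W] [Module ℂ W]

theorem leftRegular_character_one : (leftRegular ℂ G).character 1 = Nat.card G := by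
  rw [char_one, finrank_monoidAlgebra]

theorem leftRegular_character_of_ne_one {g : G} (hg : g ≠ 1) :
    (leftRegular ℂ G).character g = 0 := by
  classical
  rw [character, LinearMap.trace_eq_matrix_trace ℂ (MonoidAlgebra.basis G ℂ), Matrix.trace]
  refine Finset.sum_eq_zero fun h _ ↦ ?_
  simp [LinearMap.toMatrix_apply, MonoidAlgebra.basis, hg]

variable [FiniteDimensional ℂ W] {σ : Representation ℂ G W} {n : ℕ}
  {S : Fin n → Subrepresentation (leftRegular ℂ G)}

theorem card_isoIndices_leftRegular [IsIrreducible σ]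
    (hS : DirectSum.IsInternal (fun i ↦ (S i).toSubmodule))
    (hirr : ∀ i, IsIrreducible (S i).toRepresentation) :
    (isoIndices S σ).card = finrank ℂ W := by
  have h := charPairing_eq_card_isoIndices (σ := σ) hS hirr
  -- The regular character is supported at 1, so only that term of the pairing survives.
  rw [charPairing, Fintype.sum_eq_single 1 fun g hg ↦ by
    rw [leftRegular_character_of_ne_one hg, zero_mul], leftRegular_character_one, inv_one,
    char_one, inv_mul_cancel_left₀ (by exact_mod_cast Nat.card_pos.ne')] at h
  exact_mod_cast h.symm

theorem sum_finrank_isoIndices_leftRegular [IsIrreducible σ]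
    (hS : DirectSum.IsInternal (fun i ↦ (S i).toSubmodule))
    (hirr : ∀ i, IsIrreducible (S i).toRepresentation) :
    ∑ i ∈ isoIndices S σ, finrank ℂ (S i).toSubmodule = finrank ℂ W ^ 2 := by
  rw [sum_finrank_isoIndices, card_isoIndices_leftRegular hS hirr, sq]

end Regular

/-! ### Bounds on sums of squared degrees -/

section Bessel

theorem isEmpty_equiv_of_finrank_ne {G V W : Type*} [Group G] [AddCommGroup V] [Module ℂ V]
    [AddCommGroup W] [Module ℂ W] {ρ : Representation ℂ G V} {σ : Representation ℂ G W}
    (h : finrank ℂ V ≠ finrank ℂ W) : IsEmpty (Representation.Equiv ρ σ) :=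
  ⟨fun e ↦ h e.toLinearEquiv.finrank_eq⟩

variable {G V₁ V₂ V₃ : Type*} [Group G] [Finite G]
  [AddCommGroup V₁] [Module ℂ V₁] [FiniteDimensional ℂ V₁]
  [AddCommGroup V₂] [Module ℂ V₂] [FiniteDimensional ℂ V₂]
  [AddCommGroup V₃] [Module ℂ V₃] [FiniteDimensional ℂ V₃]

instance Representation.isIrreducible_trivial {G : Type*} [Group G] :
    IsIrreducible (trivial ℂ G ℂ) where
  exists_pair_ne := by
    refine ⟨⊥, ⊤, fun h ↦ bot_ne_top (α := Submodule ℂ ℂ) ?_⟩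
    exact congrArg Subrepresentation.toSubmodule h
  eq_bot_or_eq_top T := by
    rcases eq_bot_or_eq_top T.toSubmodule with h | h
    · exact .inl (Subrepresentation.toSubmodule_injective h)
    · exact .inr (Subrepresentation.toSubmodule_injective h)

variable {ρ₁ : Representation ℂ G V₁} {ρ₂ : Representation ℂ G V₂} {ρ₃ : Representation ℂ G V₃}

theorem sq_finrank_add_le_card [IsIrreducible ρ₁] [IsIrreducible ρ₂] [IsIrreducible ρ₃]
    (h₁₂ : IsEmpty (Representation.Equiv ρ₁ ρ₂)) (h₁₃ : IsEmpty (Representation.Equiv ρ₁ ρ₃))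
    (h₂₃ : IsEmpty (Representation.Equiv ρ₂ ρ₃)) :
    finrank ℂ V₁ ^ 2 + finrank ℂ V₂ ^ 2 + finrank ℂ V₃ ^ 2 ≤ Nat.card G := by
  classical
  have := Fintype.ofFinite G
  obtain ⟨n, S, hS, hirr⟩ := exists_isInternal_isIrreducible (leftRegular ℂ G)
  have h := finrank_eq_sum_of_isInternal hS
  rw [finrank_monoidAlgebra] at h
  have d₁₂ := disjoint_isoIndices (S := S) h₁₂
  have d₁₃ := disjoint_isoIndices (S := S) h₁₃
  have d₂₃ := disjoint_isoIndices (S := S) h₂₃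
  rw [h, ← sum_finrank_isoIndices_leftRegular (σ := ρ₁) hS hirr,
    ← sum_finrank_isoIndices_leftRegular (σ := ρ₂) hS hirr,
    ← sum_finrank_isoIndices_leftRegular (σ := ρ₃) hS hirr, ← Finset.sum_union d₁₂,
    ← Finset.sum_union (Finset.disjoint_union_left.2 ⟨d₁₃, d₂₃⟩)]
  exact Finset.sum_le_univ_sum_of_nonneg fun _ ↦ Nat.zero_le _

/-- The trivial representation is a fourth constituent. The extra 1 makes an inequality strict in
`character_mul_character_eq`. -/
theorem sq_finrank_add_one_le_card [IsIrreducible ρ₁] [IsIrreducible ρ₂] [IsIrreducible ρ₃]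
    (h₁₂ : IsEmpty (Representation.Equiv ρ₁ ρ₂)) (h₁₃ : IsEmpty (Representation.Equiv ρ₁ ρ₃))
    (h₂₃ : IsEmpty (Representation.Equiv ρ₂ ρ₃)) (h₁ : finrank ℂ V₁ ≠ 1) (h₂ : finrank ℂ V₂ ≠ 1)
    (h₃ : finrank ℂ V₃ ≠ 1) :
    finrank ℂ V₁ ^ 2 + finrank ℂ V₂ ^ 2 + finrank ℂ V₃ ^ 2 + 1 ≤ Nat.card G := by
  classical
  have := Fintype.ofFinite G
  obtain ⟨n, S, hS, hirr⟩ := exists_isInternal_isIrreducible (leftRegular ℂ G)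
  have h := finrank_eq_sum_of_isInternal hS
  rw [finrank_monoidAlgebra] at h
  have d₁₂ := disjoint_isoIndices (S := S) h₁₂
  have d₁₃ := disjoint_isoIndices (S := S) h₁₃
  have d₂₃ := disjoint_isoIndices (S := S) h₂₃
  rw [← finrank_self ℂ] at h₁ h₂ h₃
  have d₁ := disjoint_isoIndices (S := S)
    (isEmpty_equiv_of_finrank_ne (ρ := ρ₁) (σ := trivial ℂ G ℂ) h₁)
  have d₂ := disjoint_isoIndices (S := S)
    (isEmpty_equiv_of_finrank_ne (ρ := ρ₂) (σ := trivial ℂ G ℂ) h₂)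
  have d₃ := disjoint_isoIndices (S := S)
    (isEmpty_equiv_of_finrank_ne (ρ := ρ₃) (σ := trivial ℂ G ℂ) h₃)
  have h1 : 1 = finrank ℂ ℂ ^ 2 := by simp
  rw [h, h1, ← sum_finrank_isoIndices_leftRegular (σ := ρ₁) hS hirr,
    ← sum_finrank_isoIndices_leftRegular (σ := ρ₂) hS hirr,
    ← sum_finrank_isoIndices_leftRegular (σ := ρ₃) hS hirr,
    ← sum_finrank_isoIndices_leftRegular (σ := (trivial ℂ G ℂ)) hS hirr,
    ← Finset.sum_union d₁₂, ← Finset.sum_union (Finset.disjoint_union_left.2 ⟨d₁₃, d₂₃⟩),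
    ← Finset.sum_union (Finset.disjoint_union_left.2
      ⟨Finset.disjoint_union_left.2 ⟨d₁, d₂⟩, d₃⟩)]
  exact Finset.sum_le_univ_sum_of_nonneg fun _ ↦ Nat.zero_le _

end Bessel

/-! ### Kernels and conjugacy classes read off from characters -/

section Separation

/-- The eigenvalues are roots of unity whose real parts, each at most 1, sum to the dimension, so
all equal 1. As X^n - 1 is separable, the minimal polynomial has no repeated root and divides X - 1.
-/
theorem LinearMap.eq_one_of_trace_eq_finrank {V : Type*} [AddCommGroup V] [Module ℂ V]
    [FiniteDimensional ℂ V] {f : V →ₗ[ℂ] V} {n : ℕ} (hn : n ≠ 0) (hf : f ^ n = 1)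
    (htr : LinearMap.trace ℂ V f = finrank ℂ V) : f = 1 := by
  have hroot : ∀ z ∈ f.charpoly.roots, z ^ n = 1 := by
    intro z hz
    have hz' : Module.End.HasEigenvalue f z := by
      rw [Module.End.hasEigenvalue_iff_isRoot_charpoly]
      exact Polynomial.isRoot_of_mem_roots hz
    obtain ⟨v, hv⟩ := hz'.exists_hasEigenvector
    have h := hv.pow_apply n
    rw [hf] at h
    have h' : (z ^ n - 1) • v = 0 := by rw [sub_smul, ← h]; simp
    exact sub_eq_zero.1 ((smul_eq_zero.1 h').resolve_right hv.2)
  have hsplit : f.charpoly.Splits := IsAlgClosed.splits _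
  have hcard : Multiset.card f.charpoly.roots = finrank ℂ V := by
    rw [← LinearMap.charpoly_natDegree f, hsplit.natDegree_eq_card_roots]
  rw [Module.End.trace_eq_sum_roots_charpoly_of_splits hsplit] at htr
  have hone : ∀ z ∈ f.charpoly.roots, z = 1 := by
    have hnorm : ∀ z ∈ f.charpoly.roots, ‖z‖ = 1 := fun z hz ↦
      Complex.norm_eq_one_of_pow_eq_one (hroot z hz) hn
    have hsum : (f.charpoly.roots.map fun z ↦ 1 - z.re).sum = 0 := by
      rw [Multiset.sum_map_sub]
      have : (f.charpoly.roots.map Complex.re).sum = finrank ℂ V := by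
        have := congrArg Complex.re htr
        rw [← Complex.coe_reAddGroupHom, map_multiset_sum] at this
        simpa using this
      simp [this, hcard]
    have hre : ∀ z ∈ f.charpoly.roots, z.re = 1 := by
      intro z hz
      have := (Multiset.all_zero_of_le_zero_le_of_sum_eq_zero (s := f.charpoly.roots.map fun z ↦ 1 - z.re)
        ?_ hsum) _ (Multiset.mem_map_of_mem _ hz)
      · linarith
      · intro x hx
        obtain ⟨w, hw, rfl⟩ := Multiset.mem_map.1 hx
        have := Complex.re_le_norm w
        rw [hnorm w hw] at this
        linarith
    intro z hz
    have h1 := Complex.sq_norm z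
    rw [hnorm z hz, Complex.normSq_apply, hre z hz] at h1
    apply Complex.ext
    · simp [hre z hz]
    · have : z.im * z.im = 0 := by linarith
      simpa using this
  have hsep : (Polynomial.X ^ n - 1 : Polynomial ℂ).Separable :=
    Polynomial.separable_X_pow_sub_C 1 (by exact_mod_cast hn) one_ne_zero
  have hmin : minpoly ℂ f ∣ Polynomial.X ^ n - 1 := minpoly.dvd _ _ (by simp [hf])
  have hmsep := hsep.of_dvd hmin
  have hmono : (minpoly ℂ f).Monic := minpoly.monic (Algebra.IsIntegral.isIntegral f)
  have hms : (minpoly ℂ f).Splits := IsAlgClosed.splits _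
  have hdvd : minpoly ℂ f ∣ Polynomial.X - Polynomial.C 1 := by
    have hle : (minpoly ℂ f).roots ≤ {1} := by
      rw [Multiset.le_iff_subset (Polynomial.nodup_roots hmsep)]
      intro z hz
      rw [Multiset.mem_singleton]
      apply hone
      rw [Polynomial.mem_roots (LinearMap.charpoly_monic f).ne_zero]
      exact (Polynomial.isRoot_of_mem_roots hz).dvd (LinearMap.minpoly_dvd_charpoly f)
    rw [hms.eq_prod_roots_of_monic hmono]
    have := Multiset.prod_dvd_prod_of_le (Multiset.map_le_map (f := fun a ↦ Polynomial.X - Polynomial.C a) hle)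
    simpa using this
  have := Polynomial.aeval_eq_zero_of_dvd_aeval_eq_zero hdvd (minpoly.aeval ℂ f)
  simpa [sub_eq_zero] using this

variable {G V : Type*} [Group G] [AddCommGroup V] [Module ℂ V] [FiniteDimensional ℂ V]

theorem Representation.eq_one_of_character_eq_finrank [Finite G] {ρ : Representation ℂ G V} {g : G}
    (h : ρ.character g = finrank ℂ V) : ρ g = 1 :=
  LinearMap.eq_one_of_trace_eq_finrank (orderOf_pos g).ne'
    (by rw [← map_pow, pow_orderOf_eq_one, map_one]) h

variable [Fintype G]

/-- The difference of the class sums of two group elements, acting on a representation. -/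
noncomputable def classSumSub (ρ : Representation ℂ G V) (x y : G) : V →ₗ[ℂ] V :=
  ∑ h : G, (ρ (h * x * h⁻¹) - ρ (h * y * h⁻¹))

omit [FiniteDimensional ℂ V] in
theorem classSumSub_comp (ρ : Representation ℂ G V) (x y g : G) :
    classSumSub ρ x y ∘ₗ ρ g = ρ g ∘ₗ classSumSub ρ x y := by
  change classSumSub ρ x y * ρ g = ρ g * classSumSub ρ x y
  rw [classSumSub, Finset.sum_mul, Finset.mul_sum]
  refine Fintype.sum_equiv (Equiv.mulLeft g⁻¹) _ _ fun h ↦ ?_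
  simp only [sub_mul, mul_sub, ← map_mul, Equiv.coe_mulLeft]
  congr 2 <;> group

/-- By Schur's lemma the operator is a scalar, and equality of the characters makes its trace zero.
-/
theorem classSumSub_eq_zero {ρ : Representation ℂ G V} [IsIrreducible ρ] {x y : G}
    (h : ρ.character x = ρ.character y) : classSumSub ρ x y = 0 := by
  let f : IntertwiningMap ρ ρ := ⟨classSumSub ρ x y, fun g ↦ classSumSub_comp ρ x y g⟩
  obtain ⟨c, hc⟩ := (IsIrreducible.algebraMap_intertwiningMap_bijective_of_isAlgClosed
    (ρ := ρ)).2 f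
  have hc' : classSumSub ρ x y = c • (1 : V →ₗ[ℂ] V) := by
    have := congrArg IntertwiningMap.toLinearMap hc
    exact this.symm
  have htr : LinearMap.trace ℂ V (classSumSub ρ x y) = 0 := by
    rw [classSumSub, map_sum]
    refine Finset.sum_eq_zero fun g _ ↦ ?_
    rw [map_sub, sub_eq_zero]
    exact ((char_conj ρ x g).trans h).trans (char_conj ρ y g).symm
  rw [hc', map_smul, LinearMap.trace_one, smul_eq_mul] at htr
  rcases mul_eq_zero.1 htr with h0 | h0
  · rw [hc', h0, zero_smul]
  · have : Subsingleton V := finrank_zero_iff.1 (by exact_mod_cast h0)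
    exact Subsingleton.elim _ _

theorem isConj_of_character_eq {n : ℕ} {S : Fin n → Subrepresentation (leftRegular ℂ G)}
    (hS : DirectSum.IsInternal (fun i ↦ (S i).toSubmodule))
    (hirr : ∀ i, IsIrreducible (S i).toRepresentation) {x y : G}
    (h : ∀ i, (S i).toRepresentation.character x = (S i).toRepresentation.character y) :
    IsConj x y := by
  classical
  have hzero (i : Fin n) (v : MonoidAlgebra ℂ G) (hv : v ∈ (S i).toSubmodule) :
      classSumSub (leftRegular ℂ G) x y v = 0 := by
    have := hirr i
    have h0 := congrArg Subtype.val (LinearMap.congr_fun (classSumSub_eq_zero (h i)) ⟨v, hv⟩)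
    simpa [classSumSub, Subrepresentation.toRepresentation] using h0
  have hall : classSumSub (leftRegular ℂ G) x y = 0 := by
    rw [← LinearMap.ker_eq_top, eq_top_iff, ← hS.submodule_iSup_eq_top, iSup_le_iff]
    exact fun i v hv ↦ hzero i v hv
  by_contra hxy
  -- Apply the zero operator to the basis vector 1 and read the coefficient at x: conjugates of y
  -- contribute nothing, while conjugating x by 1 contributes.
  have h1 := congrArg (fun a ↦ MonoidAlgebra.coeff a x)
    (LinearMap.congr_fun hall (MonoidAlgebra.single 1 1))
  have hempty : ({g | g * (y * g⁻¹) = x} : Finset G) = ∅ :=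
    Finset.filter_eq_empty_iff.2 fun g _ hg ↦
      hxy (isConj_iff.2 ⟨g, by rwa [mul_assoc]⟩).symm
  have hmem : (1 : G) ∈ ({g | g * (x * g⁻¹) = x} : Finset G) := by simp
  simp only [classSumSub, LinearMap.sum_apply, LinearMap.sub_apply, ofMulAction_single,
    smul_eq_mul, mul_one, MonoidAlgebra.coeff_sum, MonoidAlgebra.coeff_sub,
    MonoidAlgebra.coeff_single, Finsupp.coe_finsetSum, Finset.sum_apply, Finsupp.coe_sub,
    Pi.sub_apply, Finsupp.single_apply, mul_assoc, Finset.sum_sub_distrib, Finset.sum_boole,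
    hempty, Finset.card_empty, Nat.cast_zero, sub_zero, LinearMap.zero_apply,
    MonoidAlgebra.coeff_zero, Finsupp.coe_zero, Pi.zero_apply, Nat.cast_eq_zero,
    Finset.card_eq_zero] at h1
  exact Finset.notMem_empty _ (h1 ▸ hmem)

end Separation

/-! ### Consequences of |G| = d(d + 2) -/

section LargeDegree

variable {G V W : Type*} [Group G] [Finite G] [AddCommGroup V] [Module ℂ V]
  [FiniteDimensional ℂ V] [AddCommGroup W] [Module ℂ W] [FiniteDimensional ℂ W]
  {ρ : Representation ℂ G V} {σ : Representation ℂ G W} [IsIrreducible ρ] [IsIrreducible σ]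

omit [Finite G] in
theorem finrank_pos_of_isIrreducible (ρ : Representation ℂ G V)
    [IsIrreducible ρ] : 0 < finrank ℂ V := by
  rw [finrank_pos_iff]
  by_contra h
  rw [not_nontrivial_iff_subsingleton] at h
  refine bot_ne_top (α := Subrepresentation ρ) ?_
  apply Subrepresentation.toSubmodule_injective
  exact Subsingleton.elim _ _

omit [IsIrreducible σ] in
/-- The multiplicity of an irreducible `τ` in `ρ ⊗ σ` is that of `ρ` in `Hom(σ, τ)`. -/
theorem card_isoIndices_tprod_mul_finrank_le {n : ℕ} {S : Fin n → Subrepresentation (tprod ρ σ)}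
    (hS : DirectSum.IsInternal (fun i ↦ (S i).toSubmodule))
    (hirr : ∀ i, IsIrreducible (S i).toRepresentation)
    {U : Type*} [AddCommGroup U] [Module ℂ U] [FiniteDimensional ℂ U]
    (τ : Representation ℂ G U) [IsIrreducible τ] :
    (isoIndices S τ).card * finrank ℂ V ≤ finrank ℂ W * finrank ℂ U := by
  have := Fintype.ofFinite G
  obtain ⟨m, T, hT, hT'⟩ := exists_isInternal_isIrreducible (linHom σ τ)
  have h : (isoIndices S τ).card = (isoIndices T ρ).card := by
    have h1 := charPairing_eq_card_isoIndices (σ := τ) hS hirr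
    have h2 := charPairing_eq_card_isoIndices (σ := ρ) hT hT'
    rw [charPairing_comm] at h2
    have h3 : charPairing (tprod ρ σ).character τ.character =
        charPairing ρ.character (linHom σ τ).character := by
      simp [charPairing, mul_assoc]
    rw [h1, h2] at h3
    exact_mod_cast h3
  rw [h]
  exact (card_isoIndices_mul_finrank_le hT).trans_eq (finrank_linearMap ℂ ℂ W U)

variable (hd : finrank ℂ V ≠ 1) (hG : finrank ℂ V * (finrank ℂ V + 2) = Nat.card G)

include hd hG in
/-- If `ρ` has degree `d` with `|G| = d (d + 2)`, then `ρ ⊗ σ` is `ρ`-isotypic. -/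
theorem character_mul_character_eq (hρσ : IsEmpty (Representation.Equiv ρ σ)) (g : G) :
    ρ.character g * σ.character g = finrank ℂ W * ρ.character g := by
  have hd0 := finrank_pos_of_isIrreducible ρ
  have hu0 := finrank_pos_of_isIrreducible σ
  obtain ⟨n, S, hS, hirr⟩ := exists_isInternal_isIrreducible (tprod ρ σ)
  have hdim := finrank_eq_sum_of_isInternal hS
  rw [finrank_tensorProduct] at hdim
  have hcover (i : Fin n) : i ∈ isoIndices S ρ ∨ i ∈ isoIndices S σ := by
    by_contra! hi
    have := hirr i
    have hρi : IsEmpty (Representation.Equiv ρ (S i).toRepresentation) := by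
      rw [← not_nonempty_iff, ← mem_isoIndices]; exact hi.1
    have hσi : IsEmpty (Representation.Equiv σ (S i).toRepresentation) := by
      rw [← not_nonempty_iff, ← mem_isoIndices]; exact hi.2
    have hmem : i ∈ isoIndices S (S i).toRepresentation := mem_isoIndices.2 ⟨.refl _⟩
    have hle := card_isoIndices_tprod_mul_finrank_le hS hirr (S i).toRepresentation
    have hpos : 1 ≤ (isoIndices S (S i).toRepresentation).card := Finset.card_pos.2 ⟨i, hmem⟩
    have hB := sq_finrank_add_le_card hρσ hρi hσi
    have hB' := sq_finrank_add_one_le_card hρσ hρi hσi hd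
    rw [← hG] at hB hB'
    generalize finrank ℂ V = d at *
    generalize finrank ℂ W = u at *
    generalize finrank ℂ (S i).toSubmodule = f at *
    -- A third constituent of degree f would give u² + f² ≤ 2d ≤ 2uf. If u or f is 1, this
    -- contradicts d ≥ 2; otherwise the trivial representation adds 1 on the left, contradicting (u
    -- - f)² ≥ 0.
    have h1 : d ≤ u * f := by nlinarith
    have hu : u ≠ 1 := by rintro rfl; nlinarith [sq_nonneg ((d : ℤ) - 1), show 2 ≤ d by omega]
    have hf : f ≠ 1 := by rintro rfl; nlinarith [show 2 ≤ d by omega]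
    have := hB' hu hf
    zify at *
    nlinarith [sq_nonneg ((u : ℤ) - f)]
  have hσ : isoIndices S σ = ∅ := by
    by_contra hne
    have hpos : 1 ≤ (isoIndices S σ).card := Finset.card_pos.2 (Finset.nonempty_iff_ne_empty.2 hne)
    have hle := card_isoIndices_tprod_mul_finrank_le hS hirr σ
    have hdisj := disjoint_isoIndices (S := S) hρσ
    have huniv : (Finset.univ : Finset (Fin n)) =
        (isoIndices S ρ).disjUnion (isoIndices S σ) hdisj := by
      ext i; simpa using hcover i
    rw [huniv, Finset.sum_disjUnion, sum_finrank_isoIndices, sum_finrank_isoIndices] at hdim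
    have hB (hu : finrank ℂ W ≠ 1) := sq_finrank_add_le_card (ρ₃ := trivial ℂ G ℂ) hρσ
      (isEmpty_equiv_of_finrank_ne (by rwa [finrank_self]))
      (isEmpty_equiv_of_finrank_ne (by rwa [finrank_self]))
    rw [← hG, finrank_self] at hB
    generalize finrank ℂ V = d at *
    generalize finrank ℂ W = u at *
    generalize (isoIndices S σ).card = c at *
    generalize (isoIndices S ρ).card = b at *
    have hu : u ≠ 1 := by rintro rfl; nlinarith [show 2 ≤ d by omega]
    -- With cd ≤ u² this leaves c = 1. Then du = bd + u, so d divides u, too large for this bound.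
    have hu2 : u * u + 1 ≤ 2 * d := by nlinarith [hB hu]
    have hc : c = 1 := by
      by_contra hc
      have : 2 ≤ c := by omega
      nlinarith
    subst hc
    have hdvd : d ∣ u := by
      rw [one_mul] at hdim
      exact (Nat.dvd_add_right (Dvd.intro_left b rfl)).1 (hdim ▸ Dvd.intro u rfl)
    have := Nat.le_of_dvd hu0 hdvd
    nlinarith [show 2 ≤ d by omega]
  have hall (i : Fin n) : i ∈ isoIndices S ρ := (hcover i).resolve_right (by simp [hσ])
  have hchar (x : G) : ρ.character x * σ.character x = n * ρ.character x := by
    have h := character_eq_sum_of_isInternal hS x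
    rw [char_tensor, Pi.mul_apply] at h
    rw [h, Finset.sum_congr rfl fun i _ ↦ congrFun (character_of_mem_isoIndices (hall i)) x]
    simp
  have hn : (n : ℂ) = finrank ℂ W := by
    have h := hchar 1
    rw [char_one, char_one, mul_comm] at h
    exact (mul_right_cancel₀ (by exact_mod_cast hd0.ne') h).symm
  rw [hchar, hn]

include hd hG in
-- N is the common kernel of the irreducibles other than ρ. Their characters are constant on cosets
-- of N, so within a coset χ alone decides conjugacy.
theorem exists_normal_subgroup_of_large_degree :
    ∃ N : Subgroup G, N.Normal ∧ (∀ g ∉ N, ρ.character g = 0) ∧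
      (∀ g ∈ N, g ≠ 1 → ρ.character g = -2) ∧
      (∀ x y, x⁻¹ * y ∈ N → ρ.character x = ρ.character y → IsConj x y) := by
  have := Fintype.ofFinite G
  have hd0 : (finrank ℂ V : ℂ) ≠ 0 := by exact_mod_cast (finrank_pos_of_isIrreducible ρ).ne'
  obtain ⟨n, S, hS, hirr⟩ := exists_isInternal_isIrreducible (leftRegular ℂ G)
  have hdisj := disjoint_compl_right (a := isoIndices S ρ)
  have huniv : (Finset.univ : Finset (Fin n)) =
      (isoIndices S ρ).disjUnion (isoIndices S ρ)ᶜ hdisj := by ext i; simp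
  have hrest : ∑ i ∈ (isoIndices S ρ)ᶜ, finrank ℂ (S i).toSubmodule = 2 * finrank ℂ V := by
    have h := finrank_eq_sum_of_isInternal hS
    rw [finrank_monoidAlgebra, ← hG, huniv, Finset.sum_disjUnion,
      sum_finrank_isoIndices_leftRegular hS hirr] at h
    linarith
  have hchar (g : G) (hg : g ≠ 1) : finrank ℂ V * ρ.character g +
      ∑ i ∈ (isoIndices S ρ)ᶜ, (S i).toRepresentation.character g = 0 := by
    have h := character_eq_sum_of_isInternal hS g
    rw [leftRegular_character_of_ne_one hg, huniv, Finset.sum_disjUnion,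
      Finset.sum_congr rfl fun i hi ↦ congrFun (character_of_mem_isoIndices hi) g,
      Finset.sum_const, card_isoIndices_leftRegular hS hirr, nsmul_eq_mul] at h
    exact h.symm
  let N : Subgroup G :=
    { carrier := {g | ∀ i ∈ (isoIndices S ρ)ᶜ, (S i).toRepresentation g = 1}
      one_mem' := fun i _ ↦ map_one _
      mul_mem' := fun ha hb i hi ↦ by rw [map_mul, ha i hi, hb i hi, one_mul]
      inv_mem' := fun {a} ha i hi ↦ by
        have h := map_mul (S i).toRepresentation a⁻¹ a
        rw [ha i hi, inv_mul_cancel, map_one, mul_one] at h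
        exact h.symm }
  refine ⟨N, ⟨fun a ha g i hi ↦ ?_⟩, fun g hg ↦ ?_, fun g hg hg1 ↦ ?_, fun x y hxy h ↦ ?_⟩
  · rw [map_mul, map_mul, ha i hi, mul_one, ← map_mul, mul_inv_cancel, map_one]
  · by_contra h0
    refine hg fun i hi ↦ ?_
    have := hirr i
    have hi' : IsEmpty (Representation.Equiv ρ (S i).toRepresentation) := by
      rw [← not_nonempty_iff, ← mem_isoIndices]; exact Finset.mem_compl.1 hi
    have h := character_mul_character_eq hd hG hi' g
    rw [mul_comm] at h
    exact eq_one_of_character_eq_finrank (mul_right_cancel₀ h0 h)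
  · have h := hchar g hg1
    rw [Finset.sum_congr rfl fun i hi ↦ show (S i).toRepresentation.character g =
        (finrank ℂ (S i).toSubmodule : ℂ) by rw [character, hg i hi, LinearMap.trace_one],
      ← Nat.cast_sum, hrest, Nat.cast_mul] at h
    have h' : (finrank ℂ V : ℂ) * (ρ.character g + 2) = 0 := by
      rw [← h]; push_cast; ring
    exact eq_neg_of_add_eq_zero_left ((mul_eq_zero.1 h').resolve_left hd0)
  · refine isConj_of_character_eq hS hirr fun i ↦ ?_
    by_cases hi : i ∈ isoIndices S ρ
    · rw [character_of_mem_isoIndices hi, h]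
    · have h1 := hxy i (Finset.mem_compl.2 hi)
      rw [character, character]
      rw [show y = x * (x⁻¹ * y) by group, map_mul, h1, mul_one]

include hd in
theorem card_of_character_eq_neg_two {N : Subgroup G} (h0 : ∀ g ∉ N, ρ.character g = 0)
    (h2 : ∀ g ∈ N, g ≠ 1 → ρ.character g = -2) :
    finrank ℂ V = 2 * (Nat.card N - 1) := by
  classical
  have := Fintype.ofFinite G
  have : Invertible (Nat.card G : ℂ) :=
    invertibleOfNonzero (by exact_mod_cast Nat.card_pos.ne')
  have hpair := char_orthonormal ρ (trivial ℂ G ℂ)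
  have hne : ¬ Nonempty (Representation.Equiv (trivial ℂ G ℂ) ρ) := by
    rw [not_nonempty_iff]
    exact isEmpty_equiv_of_finrank_ne (by rw [finrank_self]; exact hd.symm)
  have htriv (g : G) : (trivial ℂ G ℂ).character g = 1 := by
    simp [character, Representation.trivial]
  rw [if_neg hne] at hpair
  simp only [htriv, mul_one] at hpair
  have hsum := (mul_eq_zero.1 hpair).resolve_left
    (inv_ne_zero (by exact_mod_cast Nat.card_pos.ne'))
  -- At the identity, d is written as -2 + (d + 2), so that the sum over G is -2|N| + (d + 2).
  have hval (g : G) : ρ.character g =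
      (if g ∈ N then (-2 : ℂ) else 0) + if g = 1 then (finrank ℂ V + 2 : ℂ) else 0 := by
    by_cases hg1 : g = 1
    · subst hg1; simp [N.one_mem]
    · by_cases hg : g ∈ N
      · simp [hg, hg1, h2 g hg hg1]
      · simp [hg, hg1, h0 g hg]
  rw [Finset.sum_congr rfl fun g _ ↦ hval g, Finset.sum_add_distrib, ← Finset.sum_filter,
    Finset.sum_const, Finset.sum_ite_eq' , if_pos (Finset.mem_univ _)] at hsum
  have hcard : (Finset.univ.filter (· ∈ N)).card = Nat.card N := by
    rw [Nat.card_eq_fintype_card, Fintype.card_subtype]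
  rw [hcard, nsmul_eq_mul] at hsum
  have hpos : 0 < Nat.card N := Nat.card_pos
  have h : (finrank ℂ V + 2 : ℂ) = 2 * Nat.card N := by linear_combination hsum
  have h' : finrank ℂ V + 2 = 2 * Nat.card N := by exact_mod_cast h
  omega

end LargeDegree

theorem mainTheorem7 {G : Type*} [Group G] [Finite G]
    {V : Type*} [AddCommGroup V] [Module ℂ V] [Module (MonoidAlgebra ℂ G) V]
    [IsScalarTower ℂ (MonoidAlgebra ℂ G) V] [IsSimpleModule (MonoidAlgebra ℂ G) V]
    (d : ℕ) (hd : Module.finrank ℂ V = d) (hG : d * (d + 2) = Nat.card G) :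
    (IsCyclic G ∧ Nat.card G = 3) ∨ ((¬ ∀ a b : G, a * b = b * a) ∧ Nat.card G = 8) := by
  by_cases hd1 : d = 1
  · have h3 : Nat.card G = 3 := by rw [← hG, hd1]
    have : Fact (Nat.Prime 3) := ⟨Nat.prime_three⟩
    exact .inl ⟨isCyclic_of_prime_card h3, h3⟩
  right
  subst hd
  have hpos : 0 < Nat.card G := Nat.card_pos
  -- An infinite-dimensional V would have `finrank` 0, making |G| = 0.
  have : FiniteDimensional ℂ V :=
    Module.finite_of_finrank_pos (Nat.pos_of_ne_zero fun h ↦ by simp [← hG, h] at hpos)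
  let ρ : Representation ℂ G V := ofModule' V
  have hρ : IsIrreducible ρ := by
    rw [irreducible_iff_isSimpleModule_asModule]
    -- The group algebra action rebuilt from ρ agrees with the given one, so simplicity transfers.
    let e : ρ.asModule ≃ₗ[MonoidAlgebra ℂ G] V :=
      { ρ.asModuleEquiv with
        map_smul' := fun r x ↦ by
          change ρ.asModuleEquiv (r • x) = r • ρ.asModuleEquiv x
          rw [asModuleEquiv_map_smul]
          induction r using MonoidAlgebra.induction_linear with
          | zero => simp
          | add a b ha hb => rw [map_add, LinearMap.add_apply, ha, hb, add_smul]
          | single g a =>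
            rw [asAlgebraHom_single, LinearMap.smul_apply]
            change a • (MonoidAlgebra.single g 1 : MonoidAlgebra ℂ G) • ρ.asModuleEquiv x = _
            rw [← smul_assoc, MonoidAlgebra.smul_single, smul_eq_mul, mul_one] }
    exact IsSimpleModule.congr e
  obtain ⟨N, hN, h0, h2, hconj⟩ := exists_normal_subgroup_of_large_degree (ρ := ρ) hd1 hG
  have hcard := card_of_character_eq_neg_two (ρ := ρ) hd1 h0 h2
  have hV := finrank_pos_of_isIrreducible ρ
  have hq : 2 ≤ Nat.card N := by omega
  refine card_eq_eight_of_transitive (N := N) (fun x hx y hy hx1 hy1 ↦ ?_)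
    (fun x hx n hn ↦ ?_) ?_ hq
  · exact hconj x y (N.mul_mem (N.inv_mem hx) hy) (by rw [h2 x hx hx1, h2 y hy hy1])
  · refine hconj x (x * n) (by rwa [inv_mul_cancel_left]) ?_
    rw [h0 x hx, h0 (x * n) fun h ↦ hx ((N.mul_mem_cancel_right hn).1 h)]
  · rw [← hG, hcard]
    obtain ⟨q, hq'⟩ := Nat.exists_eq_add_of_le' (show 1 ≤ Nat.card N by omega)
    rw [hq', Nat.add_sub_cancel]
    ring
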